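/- Let $K$ be an infinite field and let $E=K\langle e_1,\dots,e_n\rangle$ be the exterior algebra on the $K$-vector space with basis $e_1,\dots,e_n$, with its standard grading $E=\bigoplus_{j}E_j$. For $F=\{i_1<\dots<i_r\}\subseteq\{1,\dots,n\}$ put $e_F=e_{i_1}\wedge\dots\wedge e_{i_r}$, a monomial of degree $r$ (so $e_\emptyset=1$). Order the monomials by the (degree) reverse lexicographic order with respect to $e_1<\dots<e_n$: $e_F<e_G$ if $|F|<|G|$, or if $|F|=|G|$, $F\neq G$ and the smallest element of the symmetric difference of $F$ and $G$ belongs to $F$. For an ideal $I\subseteq E$ let $\mathrm{in}(I)$ be the ideal generated by the largest monomials of the nonzero elements of $I$. The generic initial ideal $\mathrm{gin}(J)$ of an ideal $J\subseteq E$ is the unique ideal such that $\mathrm{in}(g(J))=\mathrm{gin}(J)$ for all $g$ in some non-empty Zariski-open subset of $\mathrm{GL}_n(K)$, where $g$ acts on $E$ by the algebra automorphism $e_j\mapsto\sum_i g_{ij}e_i$. For a graded $E$-module $M$ and a linear form $v\in E_1$ let $H^j(M,v)$ denote the cohomology at $M_j$ of the complex $\cdots\to M_{j-1}\xrightarrow{\cdot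 v}M_j\xrightarrow{\cdot v}M_{j+1}\to\cdots$. For a graded ideal $J\subseteq E$, $1\le i\le n$ and $j\in\mathbb Z$, the exterior generic annihilator numbers of $E/J$ are $$\alpha_{i,j}(E/J)=\dim_K H^j\bigl(E/(\mathrm{gin}(J)+(e_1,\dots,e_{i-1})),\,e_i\bigr).$$ **Theorem.** Let $J\subseteq E$ be a graded ideal. Then for all $1\le i\le n$ and $j\in\mathbb Z$ $$\alpha_{i,j}(E/J)=\bigl|\{\overline{e_F}\in E/\mathrm{gin}(J)\;:\;|F|=j,\ \min F\ge i+1,\ \overline{e_F}\neq 0,\ \overline{e_ie_F}=0\}\bigr|,$$ where $F$ ranges over the subsets of $\{1,\dots,n\}$, $\overline{x}$ is the residue class of $x\in E$ in $E/\mathrm{gin}(J)$, and $\min F\ge i+1$ means that every element of $F$ is at least $i+1$ (so it holds for $F=\emptyset$). -/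

import Mathlib

open Module

namespace ExteriorGin

/-! ### The exterior algebra, its monomials and its grading -/

/-- The exterior algebra `E = K⟨e₁, …, eₙ⟩`; the variables are indexed by `Fin n`. -/
abbrev E (K : Type*) [Field K] (n : ℕ) : Type _ := ExteriorAlgebra K (Fin n → K)

section Basic

variable {K : Type*} [Field K] {n : ℕ}

/-- The basis of `E` consisting of the monomials `e_F = e_{i₁} ∧ ⋯ ∧ e_{iᵣ}` for
`F = {i₁ < ⋯ < iᵣ}`. -/
noncomputable def monomialBasis (K : Type*) [Field K] (n : ℕ) : Basis (Finset (Fin n)) K (E K n) :=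
  (Pi.basisFun K (Fin n)).ExteriorAlgebra

/-- The monomial `e_F`. -/
noncomputable def mono (K : Type*) [Field K] {n : ℕ} (F : Finset (Fin n)) : E K n :=
  monomialBasis K n F

/-- The variable `e_i`, a linear form. -/
noncomputable def var (K : Type*) [Field K] {n : ℕ} (i : Fin n) : E K n :=
  ExteriorAlgebra.ι K (Pi.single i 1)

/-- The component of `E` of degree `j ∈ ℤ` (zero for negative `j`). -/
noncomputable def component (K : Type*) [Field K] (n : ℕ) (j : ℤ) : Submodule K (E K n) :=
  if 0 ≤ j then ⋀[K]^j.toNat (Fin n → K) else ⊥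

/-- A left ideal of `E` is graded if it contains the homogeneous components of its elements.
(Such an ideal is automatically two-sided.) -/
def IsGraded (J : Ideal (E K n)) : Prop :=
  J.IsHomogeneous (fun d : ℕ => ⋀[K]^d (Fin n → K))

/-! ### Initial ideals and generic initial ideals -/

/-- The (degree) reverse lexicographic order on monomials with respect to `e₁ < ⋯ < eₙ`:
`e_F < e_G` if `e_F` has smaller degree, or if the degrees agree and the smallest index in which
`F` and `G` differ belongs to `F`. -/
def RevlexLT (F G : Finset (Fin n)) : Prop :=
  F.card < G.card ∨
    (F.card = G.card ∧ ∃ k ∈ F, k ∉ G ∧ ∀ l < k, (l ∈ F ↔ l ∈ G))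

/-- `e_F` is the initial (that is, the largest) monomial of `f`. -/
def IsInitialMonomial (f : E K n) (F : Finset (Fin n)) : Prop :=
  (monomialBasis K n).repr f F ≠ 0 ∧
    ∀ G, (monomialBasis K n).repr f G ≠ 0 → G = F ∨ RevlexLT G F

/-- The initial ideal of `I`, generated by the initial monomials of the elements of `I`. -/
noncomputable def initialIdeal (I : Ideal (E K n)) : Ideal (E K n) :=
  Ideal.span {x | ∃ f ∈ I, ∃ F, IsInitialMonomial f F ∧ x = mono K F}

/-- The endomorphism of `E` induced by a matrix `A`: it maps `e_j` to `∑ i, A i j • e_i`. -/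
noncomputable def linearChange (A : Matrix (Fin n) (Fin n) K) : E K n →ₐ[K] E K n :=
  ExteriorAlgebra.map (Matrix.toLin' A)

/-- The value of a polynomial in the matrix entries. -/
noncomputable def evalAt (A : Matrix (Fin n) (Fin n) K)
    (p : MvPolynomial (Fin n × Fin n) K) : K :=
  MvPolynomial.eval (fun ij => A ij.1 ij.2) p

/-- Zariski-open subsets of `GL_n(K)`: the points where some member of a given set of polynomials
in the matrix entries does not vanish. -/
def IsZariskiOpen (U : Set (GL (Fin n) K)) : Prop :=
  ∃ S : Set (MvPolynomial (Fin n × Fin n) K),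
    U = {g : GL (Fin n) K | ∃ p ∈ S, evalAt (g : Matrix (Fin n) (Fin n) K) p ≠ 0}

/-- `I` is the generic initial ideal of `J` with respect to the reverse lexicographic order:
`in(g(J)) = I` for all `g` in some non-empty Zariski-open subset of `GL_n(K)`. -/
def IsGenericInitialIdeal (J I : Ideal (E K n)) : Prop :=
  ∃ U : Set (GL (Fin n) K), IsZariskiOpen U ∧ U.Nonempty ∧
    ∀ g ∈ U, initialIdeal (J.map (linearChange (g : Matrix (Fin n) (Fin n) K))) = I

end Basic

/-! ### Existence and uniqueness of the generic initial ideal -/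

section Existence

variable {K : Type*} [Field K] {n : ℕ}

/-- Functions of a matrix that are polynomial in its entries. -/
def IsPoly (φ : Matrix (Fin n) (Fin n) K → K) : Prop :=
  ∃ p : MvPolynomial (Fin n × Fin n) K, ∀ A, evalAt A p = φ A

theorem IsPoly.const (c : K) : IsPoly (fun _ : Matrix (Fin n) (Fin n) K => c) :=
  ⟨MvPolynomial.C c, fun A => by simp [evalAt]⟩

theorem IsPoly.entry (i j : Fin n) : IsPoly (fun A : Matrix (Fin n) (Fin n) K => A i j) :=
  ⟨MvPolynomial.X (i, j), fun A => by simp [evalAt]⟩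

theorem IsPoly.add {φ ψ : Matrix (Fin n) (Fin n) K → K} (h : IsPoly φ) (k : IsPoly ψ) :
    IsPoly (fun A => φ A + ψ A) := by
  obtain ⟨p, hp⟩ := h
  obtain ⟨q, hq⟩ := k
  exact ⟨p + q, fun A => by simp [evalAt, ← hp, ← hq]⟩

theorem IsPoly.mul {φ ψ : Matrix (Fin n) (Fin n) K → K} (h : IsPoly φ) (k : IsPoly ψ) :
    IsPoly (fun A => φ A * ψ A) := by
  obtain ⟨p, hp⟩ := h
  obtain ⟨q, hq⟩ := k
  exact ⟨p * q, fun A => by simp [evalAt, ← hp, ← hq]⟩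

theorem IsPoly.sum {ι : Type*} (s : Finset ι) {φ : ι → Matrix (Fin n) (Fin n) K → K}
    (h : ∀ i, IsPoly (φ i)) : IsPoly (fun A => ∑ i ∈ s, φ i A) := by
  choose p hp using h
  exact ⟨∑ i ∈ s, p i, fun A => by simp [evalAt, ← hp]⟩

theorem IsPoly.prod {ι : Type*} (s : Finset ι) {φ : ι → Matrix (Fin n) (Fin n) K → K}
    (h : ∀ i, IsPoly (φ i)) : IsPoly (fun A => ∏ i ∈ s, φ i A) := by
  choose p hp using h
  exact ⟨∏ i ∈ s, p i, fun A => by simp [evalAt, ← hp]⟩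

theorem IsPoly.det {ι : Type*} [Fintype ι] [DecidableEq ι]
    {M : Matrix (Fin n) (Fin n) K → Matrix ι ι K} (h : ∀ i j, IsPoly (fun A => M A i j)) :
    IsPoly (fun A => (M A).det) := by
  simp only [Matrix.det_apply']
  exact IsPoly.sum _ fun σ => (IsPoly.const _).mul (IsPoly.prod _ fun i => h _ _)

theorem isPoly_linearChange (x : E K n) (l : E K n →ₗ[K] K) :
    IsPoly (fun A => l (linearChange A x)) := by
  induction x using ExteriorAlgebra.induction generalizing l with
  | algebraMap r =>
    simp only [AlgHom.commutes]
    exact IsPoly.const _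
  | ι m =>
    have : (fun A : Matrix (Fin n) (Fin n) K => l (linearChange A (ExteriorAlgebra.ι K m))) =
        fun A => ∑ i, (∑ j, A i j * m j) * l (var K i) := by
      funext A
      have h1 : (Matrix.toLin' A) m = ∑ i, (∑ j, A i j * m j) • (Pi.single i 1 : Fin n → K) := by
        ext k
        simp [Matrix.mulVec, dotProduct, Pi.single_apply]
      rw [linearChange, ExteriorAlgebra.map_apply_ι, h1]
      simp [map_sum, var]
    rw [this]
    exact IsPoly.sum _ fun i => (IsPoly.sum _ fun j =>
      (IsPoly.entry i j).mul (IsPoly.const _)).mul (IsPoly.const _)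
  | mul a b ha hb =>
    have : (fun A : Matrix (Fin n) (Fin n) K => l (linearChange A (a * b))) =
        fun A => ∑ F, (monomialBasis K n).coord F (linearChange A a) *
          (l ∘ₗ LinearMap.mulLeft K (mono K F)) (linearChange A b) := by
      funext A
      rw [map_mul]
      conv_lhs => rw [← (monomialBasis K n).sum_repr (linearChange A a)]
      rw [Finset.sum_mul, map_sum]
      simp [mono]
    rw [this]
    exact IsPoly.sum _ fun F => (ha _).mul (hb _)
  | add a b ha hb =>
    simp only [map_add]
    exact (ha l).add (hb l)

theorem evalAt_mul (A : Matrix (Fin n) (Fin n) K) (p q : MvPolynomial (Fin n × Fin n) K) :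
    evalAt A (p * q) = evalAt A p * evalAt A q := by simp [evalAt]

/-- The points of `GL_n(K)` where a polynomial does not vanish form a non-empty set as soon as
the polynomial is non-zero. -/
theorem exists_evalAt_ne_zero [Infinite K] {p : MvPolynomial (Fin n × Fin n) K} (hp : p ≠ 0) :
    ∃ g : GL (Fin n) K, evalAt (g : Matrix (Fin n) (Fin n) K) p ≠ 0 := by
  obtain ⟨d, hd⟩ : IsPoly (fun A : Matrix (Fin n) (Fin n) K => A.det) :=
    IsPoly.det (M := fun A => A) fun i j => IsPoly.entry i j
  have hd0 : d ≠ 0 := by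
    rintro rfl
    have := hd 1
    simp [evalAt] at this
  have hpd : p * d ≠ 0 := mul_ne_zero hp hd0
  obtain ⟨x, hx⟩ : ∃ x, MvPolynomial.eval x (p * d) ≠ 0 := by
    by_contra! h
    exact hpd (MvPolynomial.funext fun x => by simpa using h x)
  let A : Matrix (Fin n) (Fin n) K := fun i j => x (i, j)
  have hA : evalAt A (p * d) ≠ 0 := hx
  rw [evalAt_mul, hd] at hA
  exact ⟨Matrix.GeneralLinearGroup.mkOfDetNeZero A (right_ne_zero_of_mul hA),
    left_ne_zero_of_mul hA⟩

/-- In a family of linear maps depending polynomially on a matrix, the dimension of the kernel is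
generically constant. -/
theorem exists_generic_finrank_ker {W Q : Type*} [AddCommGroup W] [Module K W]
    [AddCommGroup Q] [Module K Q] [FiniteDimensional K W]
    (T : Matrix (Fin n) (Fin n) K → W →ₗ[K] Q)
    (hT : ∀ (w : W) (l : Q →ₗ[K] K), IsPoly (fun A => l (T A w))) :
    ∃ p : MvPolynomial (Fin n × Fin n) K, p ≠ 0 ∧ ∃ r : ℕ,
      ∀ A, evalAt A p ≠ 0 → finrank K (LinearMap.ker (T A)) = r := by
  obtain ⟨A₀, hA₀⟩ : ∃ A₀, ∀ A, finrank K (LinearMap.ker (T A₀)) ≤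
      finrank K (LinearMap.ker (T A)) := by
    have hne : (Set.range fun A => finrank K (LinearMap.ker (T A))).Nonempty :=
      ⟨_, ⟨0, rfl⟩⟩
    obtain ⟨A₀, h⟩ := Nat.sInf_mem hne
    exact ⟨A₀, fun A => by
      rw [show finrank K (LinearMap.ker (T A₀)) = _ from h]; exact Nat.sInf_le ⟨A, rfl⟩⟩
  obtain ⟨C, hC⟩ := Submodule.exists_isCompl (LinearMap.ker (T A₀))
  have hinj : LinearMap.ker (T A₀ ∘ₗ C.subtype) = ⊥ := by
    rw [LinearMap.ker_comp, ← Submodule.disjoint_iff_comap_eq_bot]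
    exact hC.disjoint.symm
  obtain ⟨β, hβ⟩ := LinearMap.exists_leftInverse_of_injective _ hinj
  let b := finBasis K C
  obtain ⟨p, hp⟩ : IsPoly (fun A =>
      (LinearMap.toMatrix b b (β ∘ₗ T A ∘ₗ C.subtype)).det) := by
    refine IsPoly.det fun i j => ?_
    simpa [LinearMap.toMatrix_apply] using hT (b j : W) (b.coord i ∘ₗ β)
  refine ⟨p, ?_, finrank K (LinearMap.ker (T A₀)), fun A hA => le_antisymm ?_ (hA₀ A)⟩
  · rintro rfl
    have h0 := hp A₀
    simp only [hβ] at h0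
    simp [evalAt] at h0
  · simp only [hp, LinearMap.det_toMatrix] at hA
    have hinj' : Function.Injective (β ∘ₗ T A ∘ₗ C.subtype) :=
      (LinearMap.equivOfDetNeZero (β ∘ₗ T A ∘ₗ C.subtype) hA).injective
    have hdisj : Disjoint (LinearMap.ker (T A)) C := by
      rw [Submodule.disjoint_def]
      intro x hx hxC
      have : (⟨x, hxC⟩ : C) = 0 := hinj' (by
        have hx' : T A x = 0 := hx
        simp [hx'])
      simpa using congrArg Subtype.val this
    have h1 := Submodule.finrank_add_finrank_le_of_disjoint hdisj
    have h2 := Submodule.finrank_add_eq_of_isCompl hC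
    omega

/-- The elements of `E` all of whose monomials have property `P`. -/
noncomputable def supportedOn (P : Finset (Fin n) → Prop) : Submodule K (E K n) where
  carrier := {f | ∀ G, ¬ P G → (monomialBasis K n).repr f G = 0}
  add_mem' := fun ha hb G hG => by simp [ha G hG, hb G hG]
  zero_mem' := fun G _ => by simp
  smul_mem' := fun c a ha G hG => by simp [ha G hG]

theorem isInitialMonomial_iff (f : E K n) (F : Finset (Fin n)) :
    IsInitialMonomial f F ↔ f ∈ supportedOn (K := K) (fun G => G = F ∨ RevlexLT G F) ∧
      f ∉ supportedOn (K := K) (fun G => RevlexLT G F) := by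
  have hirr : ¬ RevlexLT F F := by
    rintro (h | ⟨_, k, h, h', _⟩)
    · exact lt_irrefl _ h
    · exact h' h
  constructor
  · rintro ⟨h1, h2⟩
    exact ⟨fun G hG => by_contra fun h => hG (h2 G h), fun h => h1 (h F hirr)⟩
  · rintro ⟨h1, h2⟩
    have h1' : ∀ G, (monomialBasis K n).repr f G ≠ 0 → G = F ∨ RevlexLT G F :=
      fun G hG => by_contra fun h => hG (h1 G h)
    refine ⟨fun h => h2 fun G hG => ?_, h1'⟩
    by_contra hne
    rcases h1' G hne with rfl | h'
    · exact hne h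
    · exact hG h'

theorem linearChange_surjective (g : GL (Fin n) K) :
    Function.Surjective (linearChange (g : Matrix (Fin n) (Fin n) K)) := by
  rw [linearChange, ExteriorAlgebra.map_surjective_iff]
  intro x
  refine ⟨(g⁻¹ : GL (Fin n) K).val.mulVec x, ?_⟩
  rw [Matrix.toLin'_apply, Matrix.mulVec_mulVec, ← Units.val_mul]
  simp

/-- The vectors of `J` that are mapped into `S` by the linear change of coordinates. -/
noncomputable def changeMod (J : Ideal (E K n)) (S : Submodule K (E K n))
    (A : Matrix (Fin n) (Fin n) K) : J.restrictScalars K →ₗ[K] (E K n ⧸ S) :=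
  S.mkQ ∘ₗ (linearChange A).toLinearMap ∘ₗ (J.restrictScalars K).subtype

instance : FiniteDimensional K (E K n) := (monomialBasis K n).finiteDimensional_of_finite

theorem mem_ker_changeMod (J : Ideal (E K n)) (S : Submodule K (E K n))
    (A : Matrix (Fin n) (Fin n) K) (x : J.restrictScalars K) :
    x ∈ LinearMap.ker (changeMod J S A) ↔ linearChange A (x : E K n) ∈ S := by
  simp [changeMod]

theorem exists_isGenericInitialIdeal [Infinite K] (J : Ideal (E K n)) :
    ∃ I, IsGenericInitialIdeal J I := by
  classical
  have key : ∀ S : Submodule K (E K n), ∃ p : MvPolynomial (Fin n × Fin n) K, p ≠ 0 ∧ ∃ r : ℕ,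
      ∀ A, evalAt A p ≠ 0 → finrank K (LinearMap.ker (changeMod J S A)) = r := fun S =>
    exists_generic_finrank_ker (changeMod J S) fun w l =>
      isPoly_linearChange (w : E K n) (l ∘ₗ S.mkQ)
  choose p hp r hr using key
  let S₁ : Finset (Fin n) → Submodule K (E K n) :=
    fun F => supportedOn (fun G => G = F ∨ RevlexLT G F)
  let S₂ : Finset (Fin n) → Submodule K (E K n) := fun F => supportedOn (fun G => RevlexLT G F)
  have hle : ∀ F, S₂ F ≤ S₁ F := fun F f hf G hG => hf G fun h => hG (Or.inr h)
  let q : MvPolynomial (Fin n × Fin n) K := ∏ F, (p (S₁ F) * p (S₂ F))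
  have hq : q ≠ 0 := Finset.prod_ne_zero_iff.mpr fun F _ => mul_ne_zero (hp _) (hp _)
  obtain ⟨g₀, hg₀⟩ := exists_evalAt_ne_zero hq
  refine ⟨Ideal.span {x | ∃ F, r (S₁ F) ≠ r (S₂ F) ∧ x = mono K F},
    {g : GL (Fin n) K | evalAt (g : Matrix (Fin n) (Fin n) K) q ≠ 0}, ⟨{q}, by simp⟩, ⟨g₀, hg₀⟩, ?_⟩
  intro g hg
  have hgF : ∀ F, evalAt (g : Matrix (Fin n) (Fin n) K) (p (S₁ F)) ≠ 0 ∧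
      evalAt (g : Matrix (Fin n) (Fin n) K) (p (S₂ F)) ≠ 0 := by
    intro F
    have hg' : evalAt (g : Matrix (Fin n) (Fin n) K) q ≠ 0 := hg
    simp only [q, evalAt, map_prod, map_mul, Finset.prod_ne_zero_iff] at hg'
    exact ⟨left_ne_zero_of_mul (hg' F (Finset.mem_univ F)),
      right_ne_zero_of_mul (hg' F (Finset.mem_univ F))⟩
  have hF : ∀ F, (∃ f ∈ J.map (linearChange (g : Matrix (Fin n) (Fin n) K)),
      IsInitialMonomial f F) ↔ r (S₁ F) ≠ r (S₂ F) := by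
    intro F
    rw [← hr _ _ (hgF F).1, ← hr _ _ (hgF F).2]
    have hkle : LinearMap.ker (changeMod J (S₂ F) g) ≤ LinearMap.ker (changeMod J (S₁ F) g) := by
      intro x hx
      rw [mem_ker_changeMod] at hx ⊢
      exact hle F hx
    constructor
    · rintro ⟨f, hf, hlead⟩ heq
      obtain ⟨x, hx, rfl⟩ :=
        (Ideal.mem_map_iff_of_surjective _ (linearChange_surjective g)).mp hf
      obtain ⟨h1, h2⟩ := (isInitialMonomial_iff _ _).mp hlead
      have hk := Submodule.eq_of_le_of_finrank_eq hkle heq.symm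
      exact h2 ((mem_ker_changeMod J (S₂ F) g ⟨x, hx⟩).mp
        (hk ▸ (mem_ker_changeMod J (S₁ F) g ⟨x, hx⟩).mpr h1))
    · intro hne
      obtain ⟨x, hx1, hx2⟩ : ∃ x ∈ LinearMap.ker (changeMod J (S₁ F) g),
          x ∉ LinearMap.ker (changeMod J (S₂ F) g) := by
        by_contra! h
        exact hne (by rw [le_antisymm (fun x hx => h x hx) hkle])
      rw [mem_ker_changeMod] at hx1 hx2
      exact ⟨_, Ideal.mem_map_of_mem _ x.2, (isInitialMonomial_iff _ _).mpr ⟨hx1, hx2⟩⟩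
  unfold initialIdeal
  congr 1
  ext x
  constructor
  · rintro ⟨f, hf, F, hl, rfl⟩
    exact ⟨F, (hF F).mp ⟨f, hf, hl⟩, rfl⟩
  · rintro ⟨F, hne, rfl⟩
    obtain ⟨f, hf, hl⟩ := (hF F).mpr hne
    exact ⟨f, hf, F, hl, rfl⟩

theorem IsGenericInitialIdeal.unique [Infinite K] {J I I' : Ideal (E K n)}
    (h : IsGenericInitialIdeal J I) (h' : IsGenericInitialIdeal J I') : I = I' := by
  obtain ⟨_, ⟨S, rfl⟩, ⟨g, p, hp, hgp⟩, hI⟩ := h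
  obtain ⟨_, ⟨S', rfl⟩, ⟨g', p', hp', hgp'⟩, hI'⟩ := h'
  have h0 : p ≠ 0 := fun h => hgp (by simp [h, evalAt])
  have h0' : p' ≠ 0 := fun h => hgp' (by simp [h, evalAt])
  obtain ⟨k, hk⟩ := exists_evalAt_ne_zero (mul_ne_zero h0 h0')
  rw [evalAt_mul] at hk
  rw [← hI k ⟨p, hp, left_ne_zero_of_mul hk⟩, ← hI' k ⟨p', hp', right_ne_zero_of_mul hk⟩]

end Existence

/-- The generic initial ideal `gin(J)` of an ideal `J ⊆ E` with respect to the reverse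
lexicographic order, over an infinite field. -/
noncomputable def gin {K : Type*} [Field K] [Infinite K] {n : ℕ} (J : Ideal (E K n)) :
    Ideal (E K n) :=
  (exists_isGenericInitialIdeal J).choose

theorem gin_spec {K : Type*} [Field K] [Infinite K] {n : ℕ} (J : Ideal (E K n)) :
    IsGenericInitialIdeal J (gin J) :=
  (exists_isGenericInitialIdeal J).choose_spec

/-! ### Exterior annihilator numbers -/

section Annihilator

variable {K : Type*} [Field K] {n : ℕ}

section Cohomology

variable {M : Type*} [AddCommGroup M] [Module K M] [Module (E K n) M] [IsScalarTower K (E K n) M]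

/-- For an `E`-module `M` with homogeneous components `ℳ j` and a linear form `v`, the cocycles of
degree `j` of the complex `⋯ ⟶ M_{j-1} ⟶ M_j ⟶ M_{j+1} ⟶ ⋯` given by multiplication with `v`. -/
noncomputable def cocycles (ℳ : ℤ → Submodule K M) (v : E K n) (j : ℤ) : Submodule K M :=
  ℳ j ⊓ LinearMap.ker (Algebra.lsmul K K M v)

/-- The coboundaries of degree `j` of this complex. -/
noncomputable def coboundaries (ℳ : ℤ → Submodule K M) (v : E K n) (j : ℤ) : Submodule K M :=
  (ℳ (j - 1)).map (Algebra.lsmul K K M v)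

/-- The cohomology `H^j(M, v)` of this complex. -/
abbrev cohomology (ℳ : ℤ → Submodule K M) (v : E K n) (j : ℤ) : Type _ :=
  cocycles ℳ v j ⧸ (coboundaries ℳ v j).submoduleOf (cocycles ℳ v j)

end Cohomology

/-- The component of degree `j` of `E/I`: the residue classes of the elements of `E_j`. -/
noncomputable def quotientComponent (I : Ideal (E K n)) (j : ℤ) : Submodule K (E K n ⧸ I) :=
  (component K n j).map (I.mkQ.restrictScalars K)

/-- The exterior annihilator numbers `α_{i,j}(v₁, …, vₙ; E/I)` with respect to a sequence of linear
forms: the dimension of `H^j(E/(I + (v₁, …, v_{i-1})), v_i)`. -/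
noncomputable def annihilatorNumber (v : Fin n → E K n) (I : Ideal (E K n)) (i : Fin n) (j : ℤ) :
    ℕ :=
  finrank K (cohomology (quotientComponent (I ⊔ Ideal.span (v '' {k | k < i}))) (v i) j)

/-- The exterior generic annihilator numbers
`α_{i,j}(E/J) = α_{i,j}(e₁, …, eₙ; E/gin(J))`. -/
noncomputable def genericAnnihilatorNumber [Infinite K] (J : Ideal (E K n)) (i : Fin n) (j : ℤ) :
    ℕ :=
  annihilatorNumber (var K) (gin J) i j

end Annihilator

end ExteriorGin

/-!
The only property of the generic initial ideal that matters is that it is generated by monomials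
(`isMonomial_gin`), as an initial ideal is by construction.

Let `I` be a monomial ideal of `E`. Since a product of two monomials is zero or `± 1` times a
monomial, an element lies in `I` if and only if all of its monomials do (`IsMonomial.mem_iff`), so
the residue classes of the monomials outside `I` form a basis of `E/I`. Multiplication with `e_i`
kills `e_F` if `i ∈ F`, and otherwise maps it to `± e_{F ∪ {i}}`; as `F ↦ F ∪ {i}` is injective on
the sets without `i`, no cancellation occurs. Hence the cocycles of degree `j` of `E/I` with respect
to `e_i` have as basis the classes of the `e_F ∉ I` with `|F| = j` and `e_i e_F ∈ I`
(`IsMonomial.cocycles_eq`), and the coboundaries have as basis those among them with `i ∈ F`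
(`coboundaries_quotientComponent_eq`). So the cohomology has dimension the number of `F` with
`|F| = j`, `i ∉ F`, `e_F ∉ I` and `e_{F ∪ {i}} ∈ I` (`IsMonomial.finrank_cohomology`).

This is applied to the ideal `gin(J) + (e₁, …, e_{i-1})`, which is monomial as well. It contains
`e_F` if and only if `e_F ∈ gin(J)` or `F` has an element smaller than `i`, so the condition on `F`
becomes that all elements of `F` are larger than `i`, `e_F ∉ gin(J)` and `e_i e_F ∈ gin(J)`
(`IsMonomial.annihilatorNumber_var`). Finally, distinct monomials outside `gin(J)` have distinct
residue classes.
-/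

namespace ExteriorGin

variable {K : Type*} [Field K] {n : ℕ}

/-! ### Products of monomials -/

theorem var_eq_mono (i : Fin n) : var K i = mono K {i} := by
  rw [mono, monomialBasis, ExteriorAlgebra.basis_apply_ofCard _ (Finset.card_singleton i),
    ExteriorAlgebra.ιMulti_family, ExteriorAlgebra.ιMulti_apply]
  simp [var, Set.powersetCard.ofFinEmbEquiv_symm_apply, Set.powersetCard.ofCard]

theorem mono_mul_mono_of_not_disjoint {F G : Finset (Fin n)} (h : ¬ Disjoint F G) :
    mono K F * mono K G = 0 :=
  ExteriorAlgebra.basis_mul_of_not_disjoint (Pi.basisFun K (Fin n))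
    (Set.powersetCard.ofCard (rfl : F.card = F.card))
    (Set.powersetCard.ofCard (rfl : G.card = G.card)) h

theorem exists_mono_mul_mono_of_disjoint {F G : Finset (Fin n)} (h : Disjoint F G) :
    ∃ u : K, u ≠ 0 ∧ mono K F * mono K G = u • mono K (F ∪ G) := by
  have := ExteriorAlgebra.basis_mul_of_disjoint (Pi.basisFun K (Fin n))
    (Set.powersetCard.ofCard (rfl : F.card = F.card))
    (Set.powersetCard.ofCard (rfl : G.card = G.card)) h
  set σ := Equiv.Perm.sign (Set.powersetCard.permOfDisjoint
    (s := Set.powersetCard.ofCard (rfl : F.card = F.card))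
    (t := Set.powersetCard.ofCard (rfl : G.card = G.card)) h)
  refine ⟨((σ : ℤ) : K), ?_, ?_⟩
  · rcases Int.units_eq_one_or σ with h | h <;> simp [h]
  · rw [Int.cast_smul_eq_zsmul, ← Finset.disjUnion_eq_union _ _ h]
    exact this

/-! ### Monomial ideals -/

theorem sum_repr_smul_mono (f : E K n) :
    ∑ F, (monomialBasis K n).repr f F • mono K F = f :=
  (monomialBasis K n).sum_repr f

theorem repr_mono (F : Finset (Fin n)) :
    (monomialBasis K n).repr (mono K F) = Finsupp.single F 1 :=
  (monomialBasis K n).repr_self F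

/-- A left ideal generated by monomials consists of the elements all of whose monomials are
multiples of generators. -/
theorem mem_span_mono_iff (S : Set (Finset (Fin n))) (f : E K n) :
    f ∈ Ideal.span (mono K '' S) ↔
      ∀ F, (monomialBasis K n).repr f F ≠ 0 → ∃ G ∈ S, G ⊆ F := by
  constructor
  · intro hf
    induction hf using Submodule.span_induction with
    | mem x hx =>
      obtain ⟨G, hG, rfl⟩ := hx
      intro F hF
      rw [repr_mono, Finsupp.single_apply_ne_zero] at hF
      exact ⟨G, hG, hF.1.ge⟩
    | zero => simp
    | add x y _ _ hx hy =>
      intro F hF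
      by_cases h : (monomialBasis K n).repr x F = 0
      · exact hy F (by simpa [h] using hF)
      · exact hx F h
    | smul a x _ hx =>
      intro H hH
      rw [smul_eq_mul, ← sum_repr_smul_mono a, ← sum_repr_smul_mono x, Finset.sum_mul] at hH
      simp only [Finset.mul_sum, map_sum, Finsupp.finsetSum_apply] at hH
      obtain ⟨F, -, hH⟩ := Finset.exists_ne_zero_of_sum_ne_zero hH
      obtain ⟨G, -, hH⟩ := Finset.exists_ne_zero_of_sum_ne_zero hH
      simp only [smul_mul_smul_comm, map_smul, Finsupp.smul_apply, smul_eq_mul] at hH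
      obtain ⟨A, hA, hAG⟩ := hx G (right_ne_zero_of_mul (left_ne_zero_of_mul hH))
      by_cases hd : Disjoint F G
      · obtain ⟨u, -, hu⟩ := exists_mono_mul_mono_of_disjoint (K := K) hd
        rw [hu, map_smul, repr_mono, Finsupp.smul_single, Finsupp.single_apply] at hH
        split_ifs at hH with h
        · exact ⟨A, hA, hAG.trans (h ▸ Finset.subset_union_right)⟩
        · simp at hH
      · simp [mono_mul_mono_of_not_disjoint hd] at hH
  · intro h
    rw [← sum_repr_smul_mono f]
    refine Submodule.sum_mem _ fun F _ => ?_
    by_cases hF : (monomialBasis K n).repr f F = 0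
    · simp [hF]
    obtain ⟨G, hG, hGF⟩ := h F hF
    obtain ⟨u, hu, hmul⟩ :=
      exists_mono_mul_mono_of_disjoint (K := K) (Finset.sdiff_disjoint : Disjoint (F \ G) G)
    rw [Finset.sdiff_union_of_subset hGF] at hmul
    have : mono K F = (u⁻¹ • mono K (F \ G)) * mono K G := by
      rw [smul_mul_assoc, hmul, inv_smul_smul₀ hu]
    rw [this]
    exact Submodule.smul_of_tower_mem _ _
      (Ideal.mul_mem_left _ _ (Ideal.subset_span ⟨G, hG, rfl⟩))

theorem mono_mem_span_mono_iff {S : Set (Finset (Fin n))} {F : Finset (Fin n)} :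
    mono K F ∈ Ideal.span (mono K '' S) ↔ ∃ G ∈ S, G ⊆ F := by
  rw [mem_span_mono_iff]
  simp [repr_mono, Finsupp.single_apply]

/-- A left ideal of `E` is monomial if it is generated, as a left ideal, by monomials. -/
def IsMonomial (I : Ideal (E K n)) : Prop :=
  ∃ S : Set (Finset (Fin n)), I = Ideal.span (mono K '' S)

theorem isMonomial_initialIdeal (I : Ideal (E K n)) : IsMonomial (initialIdeal I) := by
  refine ⟨{F | ∃ f ∈ I, IsInitialMonomial f F}, ?_⟩
  unfold initialIdeal
  congr 1
  ext x
  constructor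
  · rintro ⟨f, hf, F, hF, rfl⟩
    exact ⟨F, ⟨f, hf, hF⟩, rfl⟩
  · rintro ⟨F, ⟨f, hf, hF⟩, rfl⟩
    exact ⟨f, hf, F, hF, rfl⟩

theorem isMonomial_gin [Infinite K] (J : Ideal (E K n)) : IsMonomial (gin J) := by
  obtain ⟨U, -, ⟨g, hg⟩, h⟩ := gin_spec J
  exact h g hg ▸ isMonomial_initialIdeal _

theorem isMonomial_span_var (i : Fin n) :
    IsMonomial (Ideal.span (var K '' {k : Fin n | k < i})) := by
  refine ⟨(fun k => {k}) '' {k | k < i}, ?_⟩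
  rw [Set.image_image]
  simp only [var_eq_mono]

theorem IsMonomial.sup {I L : Ideal (E K n)} (hI : IsMonomial I) (hL : IsMonomial L) :
    IsMonomial (I ⊔ L) := by
  obtain ⟨S, rfl⟩ := hI
  obtain ⟨T, rfl⟩ := hL
  exact ⟨S ∪ T, by rw [Set.image_union, Ideal.span_union]⟩

/-- An element lies in a monomial ideal if and only if all of its monomials do. -/
theorem IsMonomial.mem_iff {I : Ideal (E K n)} (hI : IsMonomial I) {f : E K n} :
    f ∈ I ↔ ∀ F, (monomialBasis K n).repr f F ≠ 0 → mono K F ∈ I := by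
  obtain ⟨S, rfl⟩ := hI
  rw [mem_span_mono_iff]
  exact forall₂_congr fun F _ => mono_mem_span_mono_iff.symm

theorem IsMonomial.mono_mem_sup_iff {I L : Ideal (E K n)} (hI : IsMonomial I)
    (hL : IsMonomial L) {F : Finset (Fin n)} :
    mono K F ∈ I ⊔ L ↔ mono K F ∈ I ∨ mono K F ∈ L := by
  obtain ⟨S, rfl⟩ := hI
  obtain ⟨T, rfl⟩ := hL
  rw [← Ideal.span_union, ← Set.image_union]
  simp only [mono_mem_span_mono_iff, Set.mem_union, or_and_right, exists_or]

theorem mono_mem_span_var_iff {i : Fin n} {F : Finset (Fin n)} :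
    mono K F ∈ Ideal.span (var K '' {k : Fin n | k < i}) ↔ ∃ k ∈ F, k < i := by
  have : var K '' {k : Fin n | k < i} = mono K '' ((fun k => {k}) '' {k | k < i}) := by
    rw [Set.image_image]
    simp only [var_eq_mono]
  rw [this, mono_mem_span_mono_iff]
  simp [and_comm]

/-! ### Multiplication with a variable -/

theorem var_mul_mono_of_mem {i : Fin n} {F : Finset (Fin n)} (h : i ∈ F) :
    var K i * mono K F = 0 := by
  rw [var_eq_mono]
  exact mono_mul_mono_of_not_disjoint (by simpa using h)

theorem exists_var_mul_mono {i : Fin n} {F : Finset (Fin n)} (h : i ∉ F) :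
    ∃ u : K, u ≠ 0 ∧ var K i * mono K F = u • mono K (insert i F) := by
  rw [var_eq_mono, Finset.insert_eq]
  exact exists_mono_mul_mono_of_disjoint (by simpa using h)

theorem var_mul_mono_mem_iff {I : Ideal (E K n)} {i : Fin n} {F : Finset (Fin n)} (h : i ∉ F) :
    var K i * mono K F ∈ I ↔ mono K (insert i F) ∈ I := by
  obtain ⟨u, hu, hmul⟩ := exists_var_mul_mono (K := K) h
  rw [hmul]
  exact Submodule.smul_mem_iff (I.restrictScalars K) hu

/-- Multiplication with a variable maps distinct monomials that do not contain it to scalar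
multiples of distinct monomials, so no cancellation can occur. -/
theorem IsMonomial.var_mul_mono_mem {I : Ideal (E K n)} (hI : IsMonomial I) {i : Fin n}
    {f : E K n} (hf : var K i * f ∈ I) {F : Finset (Fin n)}
    (hF : (monomialBasis K n).repr f F ≠ 0) : var K i * mono K F ∈ I := by
  by_cases hi : i ∈ F
  · simp [var_mul_mono_of_mem hi]
  rw [var_mul_mono_mem_iff hi]
  refine hI.mem_iff.mp hf _ ?_
  rw [← sum_repr_smul_mono f, Finset.mul_sum, map_sum, Finsupp.finsetSum_apply,
    Finset.sum_eq_single F]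
  · obtain ⟨u, hu, hmul⟩ := exists_var_mul_mono (K := K) hi
    simp [hmul, repr_mono, hu, hF]
  · intro G _ hG
    by_cases hiG : i ∈ G
    · simp [var_mul_mono_of_mem hiG]
    · obtain ⟨u, hu, hmul⟩ := exists_var_mul_mono (K := K) hiG
      have : insert i G ≠ insert i F := fun h => hG (by
        rw [← Finset.erase_insert hiG, h, Finset.erase_insert hi])
      simp [hmul, repr_mono, this]
  · simp

/-! ### Homogeneous components -/

theorem mono_mem_exteriorPower (F : Finset (Fin n)) :
    mono K F ∈ ⋀[K]^F.card (Fin n → K) := by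
  rw [mono, monomialBasis, ExteriorAlgebra.basis_apply]
  exact ExteriorAlgebra.ιMulti_range K _ ⟨_, rfl⟩

theorem mem_exteriorPower_iff {d : ℕ} {f : E K n} :
    f ∈ ⋀[K]^d (Fin n → K) ↔ ∀ F, (monomialBasis K n).repr f F ≠ 0 → F.card = d := by
  constructor
  · intro hf F hF
    have hsum := congrArg Subtype.val
      (((Pi.basisFun K (Fin n)).exteriorPower d).sum_repr ⟨f, hf⟩)
    simp only [Submodule.coe_sum, Submodule.coe_smul, ← ExteriorAlgebra.basis_eq_coe_basis] at hsum
    rw [← hsum, map_sum, Finsupp.finsetSum_apply] at hF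
    obtain ⟨s, -, hs⟩ := Finset.exists_ne_zero_of_sum_ne_zero hF
    have h : (monomialBasis K n).repr ((Pi.basisFun K (Fin n)).ExteriorAlgebra s) =
        Finsupp.single (s : Finset (Fin n)) 1 := repr_mono _
    rw [map_smul, h, Finsupp.smul_single, Finsupp.single_apply_ne_zero] at hs
    rw [hs.1]
    exact s.2
  · intro h
    rw [← sum_repr_smul_mono f]
    refine Submodule.sum_mem _ fun F _ => ?_
    by_cases hF : (monomialBasis K n).repr f F = 0
    · simp [hF]
    · exact Submodule.smul_mem _ _ (h F hF ▸ mono_mem_exteriorPower F)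

theorem mem_component_iff {j : ℤ} {f : E K n} :
    f ∈ component K n j ↔ ∀ F, (monomialBasis K n).repr f F ≠ 0 → (F.card : ℤ) = j := by
  unfold component
  split_ifs with hj
  · rw [mem_exteriorPower_iff]
    refine forall₂_congr fun F _ => ?_
    omega
  · refine ⟨fun h => by simp [(Submodule.mem_bot K).mp h], fun h => ?_⟩
    rw [Submodule.mem_bot, ← sum_repr_smul_mono f]
    refine Finset.sum_eq_zero fun F _ => ?_
    by_cases hF : (monomialBasis K n).repr f F = 0
    · simp [hF]
    · have := h F hF
      omega

theorem mono_mem_component_iff {j : ℤ} {F : Finset (Fin n)} :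
    mono K F ∈ component K n j ↔ (F.card : ℤ) = j := by
  rw [mem_component_iff]
  simp [repr_mono, Finsupp.single_apply]

/-! ### Cocycles and coboundaries of quotients by monomial ideals -/

/-- The residue classes of the monomials outside a monomial ideal are linearly independent. -/
theorem IsMonomial.linearIndepOn_mk {I : Ideal (E K n)} (hI : IsMonomial I) :
    LinearIndepOn K (fun F => (Submodule.Quotient.mk (mono K F) : E K n ⧸ I))
      {F | mono K F ∉ I} := by
  rw [linearIndepOn_iff]
  intro l hl h0
  set f := Finsupp.linearCombination K (mono K) l with hf
  have hfI : f ∈ I := by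
    rw [← Submodule.Quotient.mk_eq_zero, ← h0, hf, Finsupp.linearCombination_apply,
      Finsupp.linearCombination_apply]
    exact map_finsuppSum (I.mkQ.restrictScalars K) l _
  have hrepr : (monomialBasis K n).repr f = l := (monomialBasis K n).repr_linearCombination l
  ext F
  by_contra hF
  exact (Finsupp.mem_supported K l).mp hl (Finsupp.mem_support_iff.mpr hF)
    (hI.mem_iff.mp hfI F (hrepr ▸ hF))

theorem IsMonomial.finrank_span_mk {I : Ideal (E K n)} (hI : IsMonomial I)
    {A : Set (Finset (Fin n))} (hA : ∀ F ∈ A, mono K F ∉ I) :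
    finrank K (Submodule.span K
      ((fun F => (Submodule.Quotient.mk (mono K F) : E K n ⧸ I)) '' A)) = A.ncard := by
  classical
  rw [Set.image_eq_range, finrank_span_eq_card (hI.linearIndepOn_mk.mono hA),
    ← Nat.card_eq_fintype_card, Nat.card_coe_set_eq]

theorem mk_mem_span_mk {I : Ideal (E K n)} {A : Set (Finset (Fin n))} {f : E K n}
    (h : ∀ F, (monomialBasis K n).repr f F ≠ 0 → mono K F ∉ I → F ∈ A) :
    (Submodule.Quotient.mk f : E K n ⧸ I) ∈ Submodule.span K
      ((fun F => (Submodule.Quotient.mk (mono K F) : E K n ⧸ I)) '' A) := by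
  change I.mkQ.restrictScalars K f ∈ _
  rw [← sum_repr_smul_mono f, map_sum]
  refine Submodule.sum_mem _ fun F _ => ?_
  by_cases hF : (monomialBasis K n).repr f F = 0
  · rw [hF, zero_smul, map_zero]
    exact Submodule.zero_mem _
  rw [map_smul]
  refine Submodule.smul_mem _ _ ?_
  by_cases hFI : mono K F ∈ I
  · have h0 : I.mkQ.restrictScalars K (mono K F) = 0 := (Submodule.Quotient.mk_eq_zero I).mpr hFI
    rw [h0]
    exact Submodule.zero_mem _
  · exact Submodule.subset_span ⟨F, h F hF hFI, rfl⟩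

/-- The cocycles are spanned by residue classes of monomials since, in the kernel of
multiplication with `e_i` modulo a monomial ideal, each monomial of an element is itself
annihilated. -/
theorem IsMonomial.cocycles_eq {I : Ideal (E K n)} (hI : IsMonomial I) (i : Fin n) (j : ℤ) :
    cocycles (quotientComponent I) (var K i) j = Submodule.span K
      ((fun F => (Submodule.Quotient.mk (mono K F) : E K n ⧸ I)) ''
        {F | (F.card : ℤ) = j ∧ mono K F ∉ I ∧ var K i * mono K F ∈ I}) := by
  apply le_antisymm
  · rintro _ ⟨⟨f, hf, rfl⟩, hker⟩
    have hmul : var K i * f ∈ I := (Submodule.Quotient.mk_eq_zero I).mp hker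
    exact mk_mem_span_mk fun F hF hFI =>
      ⟨mem_component_iff.mp hf F hF, hFI, hI.var_mul_mono_mem hmul hF⟩
  · rw [Submodule.span_le]
    rintro _ ⟨F, ⟨hj, -, hmul⟩, rfl⟩
    exact ⟨⟨mono K F, mono_mem_component_iff.mpr hj, rfl⟩,
      (Submodule.Quotient.mk_eq_zero I).mpr hmul⟩

/-- The coboundaries are spanned by the residue classes of the monomials divisible by `e_i`. This
holds for every ideal, monomial or not; the condition `mono K F ∉ I` discards zero classes. -/
theorem coboundaries_quotientComponent_eq (I : Ideal (E K n)) (i : Fin n) (j : ℤ) :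
    coboundaries (quotientComponent I) (var K i) j = Submodule.span K
      ((fun F => (Submodule.Quotient.mk (mono K F) : E K n ⧸ I)) ''
        {F | (F.card : ℤ) = j ∧ mono K F ∉ I ∧ i ∈ F}) := by
  apply le_antisymm
  · rintro _ ⟨_, ⟨f, hf, rfl⟩, rfl⟩
    refine mk_mem_span_mk (f := var K i * f) fun H hH hHI => ?_
    rw [← sum_repr_smul_mono f, Finset.mul_sum, map_sum, Finsupp.finsetSum_apply] at hH
    obtain ⟨F, -, hH⟩ := Finset.exists_ne_zero_of_sum_ne_zero hH
    rw [mul_smul_comm, map_smul, Finsupp.smul_apply, smul_eq_mul] at hH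
    have hcard := mem_component_iff.mp hf F (left_ne_zero_of_mul hH)
    by_cases hiF : i ∈ F
    · simp [var_mul_mono_of_mem hiF] at hH
    · obtain ⟨u, -, hmul⟩ := exists_var_mul_mono (K := K) hiF
      rw [hmul, map_smul, repr_mono, Finsupp.smul_single] at hH
      obtain ⟨rfl, -⟩ := Finsupp.single_apply_ne_zero.mp (right_ne_zero_of_mul hH)
      refine ⟨?_, hHI, Finset.mem_insert_self i F⟩
      rw [Finset.card_insert_of_notMem hiF]
      push_cast
      omega
  · rw [Submodule.span_le]
    rintro _ ⟨F, ⟨hj, -, hiF⟩, rfl⟩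
    obtain ⟨u, hu, hmul⟩ := exists_var_mul_mono (K := K) (Finset.notMem_erase i F)
    rw [Finset.insert_erase hiF] at hmul
    have hcard : ((F.erase i).card : ℤ) = j - 1 := by
      have := Finset.card_erase_add_one hiF
      omega
    refine ⟨_, ⟨u⁻¹ • mono K (F.erase i),
      Submodule.smul_mem _ _ (mono_mem_component_iff.mpr hcard), rfl⟩, ?_⟩
    change (Submodule.Quotient.mk (var K i * u⁻¹ • mono K (F.erase i)) : E K n ⧸ I) = _
    rw [mul_smul_comm, hmul, inv_smul_smul₀ hu]

/-- The cohomology of `E/I` has a basis given by the monomials that span the cocycles but do not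
lie among those that span the coboundaries. -/
theorem IsMonomial.finrank_cohomology {I : Ideal (E K n)} (hI : IsMonomial I) (i : Fin n)
    (j : ℤ) :
    finrank K (cohomology (quotientComponent I) (var K i) j) =
      {F : Finset (Fin n) | (F.card : ℤ) = j ∧ mono K F ∉ I ∧ i ∉ F ∧
        mono K (insert i F) ∈ I}.ncard := by
  have : Module.Finite K (E K n ⧸ I) :=
    Module.Finite.of_surjective (I.mkQ.restrictScalars K) (Submodule.mkQ_surjective I)
  set A : Set (Finset (Fin n)) := {F | (F.card : ℤ) = j ∧ mono K F ∉ I ∧ var K i * mono K F ∈ I}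
  set B : Set (Finset (Fin n)) := {F | (F.card : ℤ) = j ∧ mono K F ∉ I ∧ i ∈ F}
  have hBA : B ⊆ A := fun F hF => ⟨hF.1, hF.2.1, by simp [var_mul_mono_of_mem hF.2.2]⟩
  have hle : coboundaries (quotientComponent I) (var K i) j ≤
      cocycles (quotientComponent I) (var K i) j := by
    rw [hI.cocycles_eq, coboundaries_quotientComponent_eq]
    exact Submodule.span_mono (Set.image_mono hBA)
  have hdim := Submodule.finrank_quotient_add_finrank
    ((coboundaries (quotientComponent I) (var K i) j).submoduleOf
      (cocycles (quotientComponent I) (var K i) j))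
  have hcob : finrank K (coboundaries (quotientComponent I) (var K i) j) = B.ncard := by
    rw [coboundaries_quotientComponent_eq, hI.finrank_span_mk fun F hF => hF.2.1]
  have hcoc : finrank K (cocycles (quotientComponent I) (var K i) j) = A.ncard := by
    rw [hI.cocycles_eq, hI.finrank_span_mk fun F hF => hF.2.1]
  rw [(Submodule.submoduleOfEquivOfLe hle).finrank_eq, hcob, hcoc] at hdim
  have hdiff : A \ B = {F : Finset (Fin n) | (F.card : ℤ) = j ∧ mono K F ∉ I ∧ i ∉ F ∧
      mono K (insert i F) ∈ I} := by
    ext F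
    constructor
    · rintro ⟨⟨h1, h2, h3⟩, h4⟩
      have hi : i ∉ F := fun hi => h4 ⟨h1, h2, hi⟩
      exact ⟨h1, h2, hi, (var_mul_mono_mem_iff hi).mp h3⟩
    · rintro ⟨h1, h2, hi, h3⟩
      exact ⟨⟨h1, h2, (var_mul_mono_mem_iff hi).mpr h3⟩, fun h => hi h.2.2⟩
  rw [← hdiff]
  exact Nat.add_right_cancel (hdim.trans (Set.ncard_sdiff_add_ncard_of_subset hBA).symm)

/-- Passing to the quotient by `e₁, …, e_{i-1}` discards exactly the monomials that involve one of
these variables; as the monomials divisible by `e_i` do not contribute to the cohomology either,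
those with all indices larger than `i` remain. -/
theorem IsMonomial.annihilatorNumber_var {I : Ideal (E K n)} (hI : IsMonomial I) (i : Fin n)
    (j : ℤ) :
    annihilatorNumber (var K) I i j =
      {F : Finset (Fin n) | (F.card : ℤ) = j ∧ (∀ k ∈ F, i < k) ∧ mono K F ∉ I ∧
        var K i * mono K F ∈ I}.ncard := by
  rw [annihilatorNumber, (hI.sup (isMonomial_span_var i)).finrank_cohomology]
  congr 1
  ext F
  simp only [Set.mem_ofPred_eq, hI.mono_mem_sup_iff (isMonomial_span_var i),
    mono_mem_span_var_iff, not_or, not_exists, not_and, not_lt, Finset.mem_insert]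
  constructor
  · rintro ⟨hj, ⟨hFI, hge⟩, hi, h⟩
    refine ⟨hj, fun k hk => lt_of_le_of_ne (hge k hk) (by rintro rfl; exact hi hk), hFI, ?_⟩
    rw [var_mul_mono_mem_iff hi]
    refine h.resolve_right ?_
    rintro ⟨k, rfl | hk, hlt⟩
    · exact lt_irrefl _ hlt
    · exact absurd hlt (hge k hk).not_gt
  · rintro ⟨hj, hgt, hFI, h⟩
    have hi : i ∉ F := fun hi => lt_irrefl _ (hgt i hi)
    exact ⟨hj, ⟨hFI, fun k hk => (hgt k hk).le⟩, hi, Or.inl ((var_mul_mono_mem_iff hi).mp h)⟩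

end ExteriorGin

theorem theorem3p7 {K : Type*} [Field K] [Infinite K] {n : ℕ}
    (J : Ideal (ExteriorGin.E K n)) (hJ : ExteriorGin.IsGraded J) (i : Fin n) (j : ℤ) :
    ExteriorGin.genericAnnihilatorNumber J i j =
      Set.ncard {x : ExteriorGin.E K n ⧸ ExteriorGin.gin J |
        ∃ F : Finset (Fin n),
          x = Submodule.Quotient.mk (ExteriorGin.mono K F) ∧ (F.card : ℤ) = j ∧
          (∀ k ∈ F, i < k) ∧ x ≠ 0 ∧
          (Submodule.Quotient.mk (ExteriorGin.var K i * ExteriorGin.mono K F) :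
            ExteriorGin.E K n ⧸ ExteriorGin.gin J) = 0} := by
  rw [ExteriorGin.genericAnnihilatorNumber,
    (ExteriorGin.isMonomial_gin J).annihilatorNumber_var,
    ← Set.InjOn.ncard_image ((ExteriorGin.isMonomial_gin J).linearIndepOn_mk.injOn.mono
      fun F hF => hF.2.2.1)]
  congr 1
  ext x
  simp only [Set.mem_image, Set.mem_ofPred_eq]
  constructor
  · rintro ⟨F, ⟨hj, hgt, hF, h⟩, rfl⟩
    exact ⟨F, rfl, hj, hgt, fun h0 => hF ((Submodule.Quotient.mk_eq_zero _).mp h0),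
      (Submodule.Quotient.mk_eq_zero _).mpr h⟩
  · rintro ⟨F, rfl, hj, hgt, hF, h⟩
    exact ⟨F, ⟨hj, hgt, fun h0 => hF ((Submodule.Quotient.mk_eq_zero _).mpr h0),
      (Submodule.Quotient.mk_eq_zero _).mp h⟩, rfl⟩
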